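/- All digraphs are finite, with a nonempty vertex set, and oriented: no loops, and at most one arc between any two vertices. Write $x\to y$ for an arc from $x$ to $y$, $N^+(v)=\{w : v\to w\}$, and let $N^{++}(v)$ be the set of vertices at distance exactly $2$ from $v$, i.e. the vertices $w\ne v$ with $w\notin N^+(v)$ such that $v\to x\to w$ for some vertex $x$. A vertex $v$ has the second neighborhood property (SNP) if $|N^+(v)|\le |N^{++}(v)|$. A missing edge of $D$ is an unordered pair $xy$ of distinct vertices with neither $x\to y$ nor $y\to x$; the missing graph of $D$ is the graph formed by the missing edges. We say that $D$ misses disjoint paths of length at most $2$ if every connected component of its missing graph is a path with at most $2$ edges. A missing edge $e$ loses to a missing edge $f$ if one can write $e=xy$ and $f=ab$ such that $x\to a$, $b\notin N^+(x)\cup N^{++}(x)$, $y\to b$ and $a\notin N^+(y)\cup N^{++}(y)$. The dependency digraph $\Delta(D)$ has the missing edges of $D$ as vertices and an arc from $e$ to $f$ whenever $e$ loses to $f$. For missing paths $abc$ and $xyz$ of length $2$ write $abc\to xyz$ if each of $ab,bc$ loses to each of $xy,yz$. A double cycle in $\Delta(D)$ is a sequence $a_1b_1c_1,\dots,a_kb_kc_k$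 ($k\ge 1$) of pairwise disjoint missing paths of length $2$ with $a_1b_1c_1\to a_2b_2c_2\to\cdots\to a_kb_kc_k\to a_1b_1c_1$. Theorem. Let $D$ be a digraph that misses disjoint paths of length at most $2$. If the missing paths of length $2$ form double cycles in $\Delta(D)$ (that is, every missing path of length $2$ belongs to a double cycle), then $D$ has a vertex with the SNP. -/

import Mathlib

universe u

namespace Digraph

variable {V : Type u}

/-- An oriented graph: no loops, and at most one arc between any two vertices. -/
def IsOriented (D : Digraph V) : Prop :=
  (∀ u, ¬ D.Adj u u) ∧ ∀ u v, ¬ (D.Adj u v ∧ D.Adj v u)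

/-- The out-neighborhood `N⁺(v)`. -/
def outNbhd (D : Digraph V) (v : V) : Set V := {w | D.Adj v w}

/-- The second out-neighborhood `N⁺⁺(v)`: the vertices at distance exactly two from `v`. -/
def secondOutNbhd (D : Digraph V) (v : V) : Set V :=
  {w | w ≠ v ∧ ¬ D.Adj v w ∧ ∃ x, D.Adj v x ∧ D.Adj x w}

/-- The second neighborhood property of a vertex (for finite digraphs). -/
def HasSNP (D : Digraph V) (v : V) : Prop :=
  (D.outNbhd v).ncard ≤ (D.secondOutNbhd v).ncard

/-- The graph of missing edges. It is kept on all of `V`: the whole vertices (those incident to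
no missing edge) are its isolated vertices. -/
def missingGraph (D : Digraph V) : SimpleGraph V where
  Adj x y := x ≠ y ∧ ¬ D.Adj x y ∧ ¬ D.Adj y x
  symm := ⟨fun _ _ h => ⟨h.1.symm, h.2.2, h.2.1⟩⟩
  loopless := ⟨fun _ h => h.1 rfl⟩

/-- `D` is missing disjoint paths of length at most `n`: every connected component of the missing
graph is a path with at most `n` edges. The one-vertex components (paths of length `0`) are
the whole vertices. -/
def MissesDisjointPaths (D : Digraph V) (n : ℕ) : Prop :=
  ∀ C : D.missingGraph.ConnectedComponent,
    ∃ l ≤ n, Nonempty (C.toSimpleGraph ≃g SimpleGraph.pathGraph (l + 1))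

/-- The dependency digraph `Δ(D)`. Its vertices are the missing edges of `D`; its arcs are the
pairs `(e, f)` such that `e` loses to `f`, that is, `e` and `f` can be written as `xy` and `ab`
with `x → a`, `b ∉ N⁺(x) ∪ N⁺⁺(x)`, `y → b` and `a ∉ N⁺(y) ∪ N⁺⁺(y)`. -/
def dependencyDigraph (D : Digraph V) : Digraph D.missingGraph.edgeSet where
  Adj e f := ∃ x y a b : V, (e : Sym2 V) = s(x, y) ∧ (f : Sym2 V) = s(a, b) ∧
    D.Adj x a ∧ b ∉ D.outNbhd x ∪ D.secondOutNbhd x ∧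
    D.Adj y b ∧ a ∉ D.outNbhd y ∪ D.secondOutNbhd y

/-- A missing path `abc` of length `2`, given together with a direction of traversal. -/
structure MissingPathTwo (D : Digraph V) where
  a : V
  b : V
  c : V
  hab : D.missingGraph.Adj a b
  hbc : D.missingGraph.Adj b c
  hac : a ≠ c

namespace MissingPathTwo

variable {D : Digraph V}

/-- The vertex set `{a, b, c}`. -/
def verts (P : D.MissingPathTwo) : Set V := {P.a, P.b, P.c}

/-- The missing edge `ab`, as a vertex of `Δ(D)`. -/
def edgeAB (P : D.MissingPathTwo) : D.missingGraph.edgeSet := ⟨s(P.a, P.b), P.hab⟩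

/-- The missing edge `bc`, as a vertex of `Δ(D)`. -/
def edgeBC (P : D.MissingPathTwo) : D.missingGraph.edgeSet := ⟨s(P.b, P.c), P.hbc⟩

/-- `abc → xyz`: in `Δ(D)` there is an arc from each of `ab`, `bc` to each of `xy`, `yz`. -/
def LosesTo (P Q : D.MissingPathTwo) : Prop :=
  D.dependencyDigraph.Adj P.edgeAB Q.edgeAB ∧ D.dependencyDigraph.Adj P.edgeAB Q.edgeBC ∧
  D.dependencyDigraph.Adj P.edgeBC Q.edgeAB ∧ D.dependencyDigraph.Adj P.edgeBC Q.edgeBC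

end MissingPathTwo

/-- A sequence of `k + 1` missing paths of length `2` is a double cycle in `Δ(D)`: the paths are
pairwise disjoint and each loses to the next one, the last one losing to the first
(addition in `Fin (k + 1)` is cyclic). -/
def IsDoubleCycle (D : Digraph V) {k : ℕ} (C : Fin (k + 1) → D.MissingPathTwo) : Prop :=
  (∀ i j, i ≠ j → Disjoint (C i).verts (C j).verts) ∧ ∀ i, (C i).LosesTo (C (i + 1))

/-- The missing paths of length `2` form double cycles in `Δ(D)`: each of them is a member of a
double cycle. (Reversing the direction of traversal of a member of a double cycle gives a double
cycle again, so the direction does not matter.) -/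
def PathsFormDoubleCycles (D : Digraph V) : Prop :=
  ∀ P : D.MissingPathTwo, ∃ (k : ℕ) (C : Fin (k + 1) → D.MissingPathTwo),
    D.IsDoubleCycle C ∧ ∃ i, C i = P

end Digraph

section MedianOrder

variable {α : Type*}

open Classical in
/-- The feedback property of an ordering `p` of a weighted finite set of vertices: in each
interval of the ordering, the last vertex is dominated by at least as much weight as it
dominates. -/
def FeedbackProperty (S : Finset α) (T : α → α → Prop) (ω : α → ℕ) (p : α → ℤ) : Prop :=
  ∀ v ∈ S, ∀ m : ℤ, ∑ u ∈ S with m ≤ p u ∧ p u < p v ∧ T v u, ω u ≤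
    ∑ u ∈ S with m ≤ p u ∧ p u < p v ∧ T u v, ω u

open Classical in
/-- The total weight of the arcs that go forward in the ordering `p`. -/
noncomputable def forwardWeight (S : Finset α) (T : α → α → Prop) (ω : α → ℕ) (p : α → ℤ) : ℕ :=
  ∑ u ∈ S, ∑ w ∈ S, if T u w ∧ p u < p w then ω u * ω w else 0

open Classical in
lemma forwardWeight_move (S : Finset α) (T : α → α → Prop) (ω : α → ℕ) {p : α → ℤ}
    (hp : Function.Injective p) {v : α} (hv : v ∈ S) {m : ℤ} (hm : m ≤ p v) :
    forwardWeight S T ω (fun u => if u = v then 2 * m - 1 else 2 * p u) +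
      ω v * ∑ u ∈ S with m ≤ p u ∧ p u < p v ∧ T u v, ω u =
    forwardWeight S T ω p + ω v * ∑ u ∈ S with m ≤ p u ∧ p u < p v ∧ T v u, ω u := by
  have h1 : ω v * ∑ u ∈ S with m ≤ p u ∧ p u < p v ∧ T u v, ω u =
      ∑ u ∈ S, ∑ w ∈ S, if w = v then
        (if m ≤ p u ∧ p u < p v ∧ T u v then ω u * ω v else 0) else 0 := by
    rw [Finset.mul_sum, Finset.sum_filter]
    refine Finset.sum_congr rfl fun u _ => ?_
    rw [Finset.sum_ite_eq' S v, if_pos hv, mul_comm]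
  have h2 : ω v * ∑ u ∈ S with m ≤ p u ∧ p u < p v ∧ T v u, ω u =
      ∑ u ∈ S, ∑ w ∈ S, if u = v then
        (if m ≤ p w ∧ p w < p v ∧ T v w then ω v * ω w else 0) else 0 := by
    rw [Finset.mul_sum, Finset.sum_filter, Finset.sum_comm]
    refine Finset.sum_congr rfl fun u _ => ?_
    rw [Finset.sum_ite_eq' S v, if_pos hv]
  rw [h1, h2, forwardWeight, forwardWeight, ← Finset.sum_add_distrib, ← Finset.sum_add_distrib]
  refine Finset.sum_congr rfl fun u _ => ?_
  rw [← Finset.sum_add_distrib, ← Finset.sum_add_distrib]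
  refine Finset.sum_congr rfl fun w _ => ?_
  by_cases hu : u = v <;> by_cases hw : w = v
  · subst hu; subst hw; simp
  · subst hu
    have hne : p w ≠ p u := fun e => hw (hp e)
    by_cases hT : T u w
    · simp only [hw, hT, if_true, if_false, true_and, and_true, add_zero]
      split_ifs <;> first | omega
    · simp [hw, hT]
  · subst hw
    have hne : p u ≠ p w := fun e => hu (hp e)
    by_cases hT : T u w
    · simp only [hu, hT, if_true, if_false, true_and, and_true, add_zero]
      split_ifs <;> first | omega
    · simp [hu, hT]
  · simp [hu, hw]

lemma forwardWeight_le (S : Finset α) (T : α → α → Prop) (ω : α → ℕ) (p : α → ℤ) :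
    forwardWeight S T ω p ≤ ∑ u ∈ S, ∑ w ∈ S, ω u * ω w :=
  Finset.sum_le_sum fun _ _ => Finset.sum_le_sum fun _ _ => by split_ifs <;> simp

/-- Every weighted digraph has a local median order. -/
theorem exists_feedbackProperty [Finite α] (S : Finset α) (T : α → α → Prop) (ω : α → ℕ)
    (hω : ∀ u ∈ S, 0 < ω u) :
    ∃ p : α → ℤ, Function.Injective p ∧ FeedbackProperty S T ω p := by
  classical
  obtain ⟨n, ⟨e⟩⟩ := Finite.exists_equiv_fin α
  let Q : Set ℕ := {k | ∃ p : α → ℤ, Function.Injective p ∧ forwardWeight S T ω p = k}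
  have hne : Q.Nonempty := ⟨_, fun u => ((e u : ℕ) : ℤ), fun u v h => by
    exact e.injective (Fin.ext (Int.ofNat.inj h)), rfl⟩
  have hbdd : BddAbove Q := ⟨_, by rintro k ⟨p, -, rfl⟩; exact forwardWeight_le S T ω p⟩
  obtain ⟨p, hp, hmax⟩ := Nat.sSup_mem hne hbdd
  refine ⟨p, hp, fun v hv m => ?_⟩
  rcases lt_or_ge (p v) m with hm | hm
  · rw [Finset.filter_false_of_mem]
    · simp
    · rintro u - ⟨h1, h2, -⟩; omega
  · have hmove := forwardWeight_move S T ω hp hv hm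
    have hle : forwardWeight S T ω (fun u => if u = v then 2 * m - 1 else 2 * p u) ≤
        forwardWeight S T ω p := by
      rw [hmax]
      refine le_csSup hbdd ⟨_, fun a b hab => ?_, rfl⟩
      split_ifs at hab with h1 h2 h2
      · exact h1.trans h2.symm
      · omega
      · omega
      · exact hp (by omega)
    exact Nat.le_of_mul_le_mul_left (by omega) (hω v hv)

/-- Reversing arcs that leave the last vertex preserves the feedback property. -/
lemma FeedbackProperty.flip {S : Finset α} {T T' : α → α → Prop} {ω : α → ℕ} {p : α → ℤ}
    (h : FeedbackProperty S T ω p) {f : α} (hf : ∀ u ∈ S, p u ≤ p f)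
    (h1 : ∀ u ∈ S, T' f u → T f u) (h2 : ∀ u ∈ S, T u f → T' u f)
    (h3 : ∀ u ∈ S, ∀ v ∈ S, u ≠ f → v ≠ f → (T' u v ↔ T u v)) :
    FeedbackProperty S T' ω p := by
  classical
  intro v hv m
  by_cases hvf : v = f
  · subst hvf
    refine le_trans (Finset.sum_le_sum_of_subset ?_)
      ((h v hv m).trans (Finset.sum_le_sum_of_subset ?_))
    · intro u
      simp only [Finset.mem_filter]
      exact fun ⟨a, b, c, d⟩ => ⟨a, b, c, h1 u a d⟩
    · intro u
      simp only [Finset.mem_filter]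
      exact fun ⟨a, b, c, d⟩ => ⟨a, b, c, h2 u a d⟩
  · have huf : ∀ u, p u < p v → u ≠ f := by
      rintro u hu rfl
      exact absurd (hf v hv) (by omega)
    convert h v hv m using 2
    · ext u
      simp only [Finset.mem_filter]
      exact and_congr_right fun hu => and_congr_right fun _ => and_congr_right fun hlt =>
        h3 v hv u hu hvf (huf u hlt)
    · ext u
      simp only [Finset.mem_filter]
      exact and_congr_right fun hu => and_congr_right fun _ => and_congr_right fun hlt =>
        h3 u hu v hv (huf u hlt) hvf

open Classical in
lemma FeedbackProperty.weight_from_le {S : Finset α} {T : α → α → Prop} {ω : α → ℕ} {p : α → ℤ}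
    (h : FeedbackProperty S T ω p) (hp : Function.Injective p)
    (htot : ∀ u ∈ S, ∀ v ∈ S, u ≠ v → T u v ∨ T v u)
    (hasymm : ∀ u ∈ S, ∀ v ∈ S, T u v → ¬ T v u) {f : α} (hfS : f ∈ S)
    (hf : ∀ u ∈ S, p u ≤ p f) (n : ℕ) : ∀ m : ℤ, p f - m < n →
    ∑ u ∈ S with m ≤ p u ∧ T f u, ω u ≤
      ∑ w ∈ S with m ≤ p w ∧ T w f ∧ ∃ u ∈ S, T f u ∧ T u w, ω w := by
  induction n with
  | zero =>
    intro m hm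
    rw [Finset.filter_false_of_mem]
    · simp
    · rintro u hu ⟨h1, -⟩
      have := hf u hu
      push_cast at hm
      omega
  | succ n ih =>
    intro m hm
    have hlt : ∀ u ∈ S, u ≠ f → p u < p f := fun u hu hne =>
      lt_of_le_of_ne (hf u hu) (fun e => hne (hp e))
    have hff : ¬ T f f := fun e => hasymm f hfS f hfS e e
    let bad := S.filter fun w => m ≤ p w ∧ T w f ∧ ¬ ∃ u ∈ S, m ≤ p u ∧ p u < p w ∧ T f u ∧ T u w
    rcases bad.eq_empty_or_nonempty with hbad | hbad
    · refine le_trans (Finset.sum_le_sum_of_subset ?_)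
        ((h f hfS m).trans (Finset.sum_le_sum_of_subset ?_))
      · intro u
        simp only [Finset.mem_filter]
        rintro ⟨hu, h1, h2⟩
        exact ⟨hu, h1, hlt u hu (by rintro rfl; exact hff h2), h2⟩
      · intro u
        simp only [Finset.mem_filter]
        rintro ⟨hu, h1, h2, h3⟩
        refine ⟨hu, h1, h3, ?_⟩
        by_contra hcon
        have : u ∈ bad := Finset.mem_filter.2 ⟨hu, h1, h3, fun ⟨x, hx, _, _, hx'⟩ =>
          hcon ⟨x, hx, hx'⟩⟩
        simp [hbad] at this
    · obtain ⟨b, hb, hmin⟩ := bad.exists_min_image p hbad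
      obtain ⟨hbS, hmb, hbf, hb'⟩ := Finset.mem_filter.1 hb
      have hbne : b ≠ f := by rintro rfl; exact hff hbf
      have key := h b hbS m
      have rest := ih (p b + 1) (by push_cast at hm; omega)
      have hL : ∑ u ∈ S with m ≤ p u ∧ T f u, ω u ≤
          ∑ u ∈ S with m ≤ p u ∧ p u < p b ∧ T b u, ω u +
            ∑ u ∈ S with p b + 1 ≤ p u ∧ T f u, ω u := by
        rw [← Finset.sum_union_inter]
        refine le_add_right (Finset.sum_le_sum_of_subset ?_)
        intro u
        simp only [Finset.mem_filter, Finset.mem_union]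
        rintro ⟨hu, h1, h2⟩
        rcases lt_trichotomy (p u) (p b) with h3 | h3 | h3
        · left
          refine ⟨hu, h1, h3, ?_⟩
          rcases htot u hu b hbS (by rintro rfl; omega) with h4 | h4
          · exact absurd ⟨u, hu, h1, h3, h2, h4⟩ hb'
          · exact h4
        · rw [hp h3] at h2
          exact absurd h2 (hasymm b hbS f hfS hbf)
        · exact Or.inr ⟨hu, by omega, h2⟩
      have hR : ∑ u ∈ S with m ≤ p u ∧ p u < p b ∧ T u b, ω u +
            ∑ w ∈ S with p b + 1 ≤ p w ∧ T w f ∧ ∃ u ∈ S, T f u ∧ T u w, ω w ≤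
          ∑ w ∈ S with m ≤ p w ∧ T w f ∧ ∃ u ∈ S, T f u ∧ T u w, ω w := by
        rw [← Finset.sum_union]
        · refine Finset.sum_le_sum_of_subset ?_
          intro u
          simp only [Finset.mem_filter, Finset.mem_union]
          rintro (⟨hu, h1, h2, h3⟩ | ⟨hu, h1, h2⟩)
          · have huf : u ≠ f := by
              rintro rfl
              have := hf b hbS
              omega
            have hTuf : T u f := by
              rcases htot u hu f hfS huf with h4 | h4
              · exact h4
              · exact absurd ⟨u, hu, h1, h2, h4, h3⟩ hb'
            refine ⟨hu, h1, hTuf, ?_⟩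
            by_contra hcon
            have hub : u ∈ bad := Finset.mem_filter.2 ⟨hu, h1, hTuf, fun ⟨x, hx, _, _, hx'⟩ =>
              hcon ⟨x, hx, hx'⟩⟩
            have := hmin u hub
            omega
          · exact ⟨hu, by omega, h2⟩
        · rw [Finset.disjoint_left]
          intro u
          simp only [Finset.mem_filter]
          rintro ⟨-, -, h1, -⟩ ⟨-, h2, -⟩
          omega
      omega

open Classical in
/-- In a tournament, the last vertex of a local median order has the weighted second neighborhood
property. -/
theorem FeedbackProperty.weight_le {S : Finset α} {T : α → α → Prop} {ω : α → ℕ} {p : α → ℤ}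
    (h : FeedbackProperty S T ω p) (hp : Function.Injective p)
    (htot : ∀ u ∈ S, ∀ v ∈ S, u ≠ v → T u v ∨ T v u)
    (hasymm : ∀ u ∈ S, ∀ v ∈ S, T u v → ¬ T v u) {f : α} (hfS : f ∈ S)
    (hf : ∀ u ∈ S, p u ≤ p f) :
    ∑ u ∈ S with T f u, ω u ≤ ∑ w ∈ S with T w f ∧ ∃ u ∈ S, T f u ∧ T u w, ω w := by
  obtain ⟨v, hv, hmin⟩ := S.exists_min_image p ⟨f, hfS⟩
  have := h.weight_from_le hp htot hasymm hfS hf ((p f - p v).toNat + 1) (p v)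
    (by push_cast; omega)
  convert this using 2
  · ext u; simp only [Finset.mem_filter]
    exact ⟨fun ⟨a, b⟩ => ⟨a, hmin u a, b⟩, fun ⟨a, _, b⟩ => ⟨a, b⟩⟩
  · ext u; simp only [Finset.mem_filter]
    exact ⟨fun ⟨a, b⟩ => ⟨a, hmin u a, b⟩, fun ⟨a, _, b⟩ => ⟨a, b⟩⟩

/-- The digraph obtained from `T` by reversing the arc from `f` to `y`. -/
def reverseArc (T : α → α → Prop) (f y u v : α) : Prop :=
  (T u v ∧ ¬ (u = f ∧ v = y)) ∨ (u = y ∧ v = f)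

open Classical in
/-- The second neighborhood property of the last vertex `f` survives the reversal of an arc from
`f` to `y`. -/
theorem FeedbackProperty.weight_le_of_reverse {S : Finset α} {T : α → α → Prop} {ω : α → ℕ}
    {p : α → ℤ} (h : FeedbackProperty S T ω p) (hp : Function.Injective p)
    (htot : ∀ u ∈ S, ∀ v ∈ S, u ≠ v → T u v ∨ T v u)
    (hasymm : ∀ u ∈ S, ∀ v ∈ S, T u v → ¬ T v u) {f y : α} (hfS : f ∈ S)
    (hf : ∀ u ∈ S, p u ≤ p f) (hne : f ≠ y) :
    ∑ u ∈ S with T f u ∧ u ≠ y, ω u ≤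
      ∑ w ∈ S with w ≠ f ∧ (T w f ∨ w = y) ∧ ∃ u ∈ S, (T f u ∧ u ≠ y) ∧ T u w, ω w := by
  have hfirst : ∀ u, reverseArc T f y f u ↔ T f u ∧ u ≠ y := by
    intro u
    simp [reverseArc, hne]
  have h' : FeedbackProperty S (reverseArc T f y) ω p := by
    refine h.flip hf (fun u _ hu => ((hfirst u).1 hu).1)
      (fun u _ hu => Or.inl ⟨hu, fun h' => hne h'.2⟩) fun u _ v _ h1 h2 => ?_
    simp [reverseArc, h1, h2]
  have key := h'.weight_le hp ?_ ?_ hfS hf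
  · refine le_trans (Finset.sum_le_sum_of_subset ?_)
      (key.trans (Finset.sum_le_sum_of_subset ?_))
    · intro u hu
      rw [Finset.mem_filter] at hu ⊢
      exact ⟨hu.1, (hfirst u).2 hu.2⟩
    · intro w hw
      rw [Finset.mem_filter] at hw ⊢
      obtain ⟨hwS, hwf, u, hu, hfu, huw⟩ := hw
      have hwne : w ≠ f := by
        rintro rfl
        exact hasymm w hwS w hwS ((hfirst w).1 hwf).1 ((hfirst w).1 hwf).1
      refine ⟨hwS, hwne, hwf.imp And.left And.left, u, hu, (hfirst u).1 hfu, ?_⟩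
      exact huw.elim And.left fun h => absurd h.2 hwne
  · intro u hu v hv huv
    by_cases h1 : u = f ∧ v = y
    · exact Or.inr (Or.inr ⟨h1.2, h1.1⟩)
    · by_cases h2 : v = f ∧ u = y
      · exact Or.inl (Or.inr ⟨h2.2, h2.1⟩)
      · exact (htot u hu v hv huv).imp (fun h => Or.inl ⟨h, h1⟩) (fun h => Or.inl ⟨h, h2⟩)
  · rintro u hu v hv (⟨h1, h2⟩ | ⟨rfl, rfl⟩) (⟨h3, h4⟩ | ⟨h3, h4⟩)
    · exact hasymm u hu v hv h1 h3
    · exact h2 ⟨h4, h3⟩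
    · exact h4 ⟨rfl, rfl⟩
    · exact hne h3

end MedianOrder

namespace Digraph

variable {V : Type u} {D : Digraph V}

/-- An oriented graph whose missing graph has no path on four vertices, no triangle and no vertex
of degree three. -/
structure MissesShortPaths (D : Digraph V) : Prop where
  irrefl : ∀ u, ¬ D.Adj u u
  asymm : ∀ {u v}, D.Adj u v → ¬ D.Adj v u
  eq_or_eq : ∀ {x y z w}, D.missingGraph.Adj x y → D.missingGraph.Adj y z →
    D.missingGraph.Adj z w → x = z ∨ y = w
  no_triangle : ∀ {x y z}, D.missingGraph.Adj x y → D.missingGraph.Adj y z →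
    ¬ D.missingGraph.Adj x z
  degree_le_two : ∀ {y a b c}, D.missingGraph.Adj y a → D.missingGraph.Adj y b →
    D.missingGraph.Adj y c → a = b ∨ b = c ∨ a = c

lemma MissesDisjointPaths.exists_coordinate (h : D.MissesDisjointPaths 2) (y : V) :
    ∃ φ : V → ℕ, ∀ u v, D.missingGraph.Reachable u y → D.missingGraph.Reachable v y →
      φ u < 3 ∧ (φ u = φ v → u = v) ∧
      (D.missingGraph.Adj u v → φ u + 1 = φ v ∨ φ v + 1 = φ u) := by
  classical
  obtain ⟨l, hl, ⟨e⟩⟩ := h (D.missingGraph.connectedComponentMk y)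
  refine ⟨fun u => if hu : D.missingGraph.Reachable u y then
    (e ⟨u, SimpleGraph.ConnectedComponent.sound hu⟩ : ℕ) else 0, fun u v hu hv => ?_⟩
  simp only [hu, hv, dif_pos]
  refine ⟨by omega, fun huv => ?_, fun huv => ?_⟩
  · have := e.injective (Fin.ext huv)
    exact congrArg Subtype.val this
  · have h2 := e.map_adj_iff (v := ⟨u, SimpleGraph.ConnectedComponent.sound hu⟩)
      (w := ⟨v, SimpleGraph.ConnectedComponent.sound hv⟩)
    rw [SimpleGraph.pathGraph_adj] at h2
    exact h2.2 huv

lemma MissesDisjointPaths.missesShortPaths (h : D.MissesDisjointPaths 2) (hD : D.IsOriented) :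
    D.MissesShortPaths where
  irrefl := hD.1
  asymm h1 h2 := hD.2 _ _ ⟨h1, h2⟩
  eq_or_eq {x y z w} h1 h2 h3 := by
    obtain ⟨φ, hφ⟩ := h.exists_coordinate y
    have rx := h1.reachable
    have ry := SimpleGraph.Reachable.refl (G := D.missingGraph) y
    have rz := h2.reachable.symm
    have rw' := h3.reachable.symm.trans rz
    have a1 := hφ x y rx ry
    have a2 := hφ x z rx rz
    have a3 := hφ y w ry rw'
    have a4 := (hφ y z ry rz).2.2 h2
    have a5 := (hφ z w rz rw').2.2 h3
    have a6 := a1.2.2 h1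
    have a7 := (hφ w w rw' rw').1
    have a8 := (hφ z z rz rz).1
    have : φ x = φ z ∨ φ y = φ w := by omega
    exact this.imp a2.2.1 a3.2.1
  no_triangle {x y z} h1 h2 h3 := by
    obtain ⟨φ, hφ⟩ := h.exists_coordinate y
    have rx := h1.reachable
    have ry := SimpleGraph.Reachable.refl (G := D.missingGraph) y
    have rz := h2.reachable.symm
    have a1 := (hφ x y rx ry).2.2 h1
    have a2 := (hφ x z rx rz).2.2 h3
    have a3 := (hφ y z ry rz).2.2 h2
    omega
  degree_le_two {y a b c} h1 h2 h3 := by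
    obtain ⟨φ, hφ⟩ := h.exists_coordinate y
    have ry := SimpleGraph.Reachable.refl (G := D.missingGraph) y
    have ra := h1.reachable.symm
    have rb := h2.reachable.symm
    have rc := h3.reachable.symm
    have a1 := (hφ y a ry ra).2.2 h1
    have a2 := (hφ y b ry rb).2.2 h2
    have a3 := (hφ y c ry rc).2.2 h3
    have : φ a = φ b ∨ φ b = φ c ∨ φ a = φ c := by omega
    exact this.imp (hφ a b ra rb).2.1 (Or.imp (hφ b c rb rc).2.1 (hφ a c ra rc).2.1)

lemma adj_or_adj {u v : V} (hne : u ≠ v) (h : ¬ D.missingGraph.Adj u v) :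
    D.Adj u v ∨ D.Adj v u := by
  by_contra hcon
  exact h ⟨hne, fun h1 => hcon (Or.inl h1), fun h1 => hcon (Or.inr h1)⟩

/-- The missing edge `xy` loses to the missing edge `ab`, with `x → a` and `y → b`. -/
def Loses (D : Digraph V) (x y a b : V) : Prop :=
  D.missingGraph.Adj x y ∧ D.missingGraph.Adj a b ∧
    D.Adj x a ∧ b ∉ D.outNbhd x ∪ D.secondOutNbhd x ∧
    D.Adj y b ∧ a ∉ D.outNbhd y ∪ D.secondOutNbhd y

lemma Loses.symm {x y a b : V} (h : D.Loses x y a b) : D.Loses y x b a :=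
  ⟨h.1.symm, h.2.1.symm, h.2.2.2.2.1, h.2.2.2.2.2, h.2.2.1, h.2.2.2.1⟩

lemma loses_or_loses_of_adj {p q r w : V} {e f : D.missingGraph.edgeSet}
    (h : D.dependencyDigraph.Adj e f) (he : (e : Sym2 V) = s(p, q)) (hf : (f : Sym2 V) = s(r, w)) :
    D.Loses p q r w ∨ D.Loses p q w r := by
  obtain ⟨x, y, a, b, h1, h2, h3⟩ := h
  have hxy : D.missingGraph.Adj x y := by have := e.2; rwa [h1] at this
  have hab : D.missingGraph.Adj a b := by have := f.2; rwa [h2] at this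
  have hL : D.Loses x y a b := ⟨hxy, hab, h3⟩
  rw [he, Sym2.eq_iff] at h1
  rw [hf, Sym2.eq_iff] at h2
  rcases h1 with ⟨rfl, rfl⟩ | ⟨rfl, rfl⟩ <;> rcases h2 with ⟨rfl, rfl⟩ | ⟨rfl, rfl⟩
  · exact Or.inl hL
  · exact Or.inr hL
  · exact Or.inr hL.symm
  · exact Or.inl hL.symm

namespace MissesShortPaths

variable {x y a b x' y' a' b' v : V}

lemma not_missing (_ : D.MissesShortPaths) (h : D.Adj x y) : ¬ D.missingGraph.Adj x y :=
  fun h' => h'.2.1 h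

lemma ne (hD : D.MissesShortPaths) (h : D.Adj x y) : x ≠ y := by
  rintro rfl; exact hD.irrefl _ h

lemma adj_of_loses (hD : D.MissesShortPaths) (h : D.Loses x y a b) : D.Adj b x := by
  obtain ⟨h1, h2, h3, h4, h5, h6⟩ := h
  have hne : b ≠ x := by rintro rfl; exact hD.not_missing h3 h2.symm
  have hm : ¬ D.missingGraph.Adj b x := by
    intro hbx
    rcases hD.eq_or_eq h2 hbx h1 with rfl | rfl
    · exact hD.irrefl _ h3
    · exact hD.irrefl _ h5
  rcases adj_or_adj hne hm with h | h
  · exact h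
  · exact absurd (Or.inl h) h4

lemma not_adj_of_loses (hD : D.MissesShortPaths) (h : D.Loses x y a b) (hv : D.Adj x v) :
    ¬ D.Adj v b := fun hvb =>
  h.2.2.2.1 (Or.inr ⟨hD.ne (hD.adj_of_loses h), fun h' => h.2.2.2.1 (Or.inl h'), v, hv, hvb⟩)

lemma missing_of_loses_right (hD : D.MissesShortPaths) (h : D.Loses x y a b)
    (h' : D.Loses x y a' b') : D.missingGraph.Adj a b' := by
  by_contra hcon
  have hne : a ≠ b' := by
    rintro rfl
    exact hD.asymm (hD.adj_of_loses h.symm) h'.2.2.2.2.1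
  rcases adj_or_adj hne hcon with h1 | h1
  · exact hD.not_adj_of_loses h' h.2.2.1 h1
  · exact hD.not_adj_of_loses h.symm h'.2.2.2.2.1 h1

lemma missing_of_loses_left (hD : D.MissesShortPaths) (h : D.Loses x y a b)
    (h' : D.Loses x' y' a b) : D.missingGraph.Adj x y' := by
  by_contra hcon
  have hne : x ≠ y' := by
    rintro rfl
    exact hD.asymm (hD.adj_of_loses h) h'.2.2.2.2.1
  rcases adj_or_adj hne hcon with h1 | h1
  · exact hD.not_adj_of_loses h h1 h'.2.2.2.2.1
  · exact hD.not_adj_of_loses h'.symm h1 h.2.2.1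

/-- If `ab` is joined by the missing edges `sb` and `at` to the path `stu`, then `b` is its center
and `a` one of its ends. -/
lemma eq_center (hD : D.MissesShortPaths) {s t u : V} (hst : D.missingGraph.Adj s t)
    (htu : D.missingGraph.Adj t u) (hsu : s ≠ u) (hab : D.missingGraph.Adj a b)
    (hsb : D.missingGraph.Adj s b) (hat : D.missingGraph.Adj a t) : b = t ∧ (a = s ∨ a = u) := by
  have hb : b = t := by
    rcases hD.eq_or_eq hsb.symm hst hat.symm with h | rfl
    · exact h
    · exact (hD.eq_or_eq hab.symm hst htu).resolve_right hsu
  subst hb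
  refine ⟨rfl, ?_⟩
  rcases hD.degree_le_two hst.symm htu hat.symm with h | h | h
  · exact absurd h hsu
  · exact Or.inr h.symm
  · exact Or.inl h.symm

lemma loses_fst (hD : D.MissesShortPaths) (h : D.Loses x y' a b ∨ D.Loses x y' b a)
    (h' : D.Loses x y a b) : D.Loses x y' a b := by
  rcases h with h | h
  · exact h
  · exact absurd h.2.2.1 (hD.asymm (hD.adj_of_loses h'))

lemma loses_congr_snd (hD : D.MissesShortPaths) (hC : D.PathsFormDoubleCycles)
    (h : D.Loses x y a b) (hy : D.missingGraph.Adj x y') : D.Loses x y' a b := by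
  by_cases hyy : y = y'
  · rwa [← hyy]
  obtain ⟨k, C, ⟨-, hC⟩, i, hi⟩ := hC ⟨y, x, y', h.1.symm, hy, hyy⟩
  have hl := hC i
  rw [hi] at hl
  generalize C (i + 1) = Q at hl
  obtain ⟨s, t, u, hst, htu, hsu⟩ := Q
  obtain ⟨l1, l2, l3, l4⟩ := hl
  have l1 := loses_or_loses_of_adj (p := x) (q := y) (r := s) (w := t) l1 Sym2.eq_swap rfl
  have l3 := loses_or_loses_of_adj (p := x) (q := y') (r := s) (w := t) l3 rfl rfl
  have l4 := loses_or_loses_of_adj (p := x) (q := y') (r := t) (w := u) l4 rfl rfl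
  rcases l1 with l1 | l1
  · obtain ⟨rfl, rfl | rfl⟩ := hD.eq_center hst htu hsu h.2.1
      (hD.missing_of_loses_right l1 h) (hD.missing_of_loses_right h l1)
    · exact hD.loses_fst l3 h
    · exact hD.loses_fst l4.symm h
  · obtain ⟨rfl, rfl | rfl⟩ := hD.eq_center hst htu hsu h.2.1.symm
      (hD.missing_of_loses_right h l1).symm (hD.missing_of_loses_right l1 h).symm
    · exact hD.loses_fst l3.symm h
    · exact hD.loses_fst l4 h

lemma loses_congr_fourth (hD : D.MissesShortPaths) (hC : D.PathsFormDoubleCycles)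
    (h : D.Loses x y a b) (hb : D.missingGraph.Adj a b') : D.Loses x y a b' := by
  by_cases hbb : b = b'
  · rwa [← hbb]
  obtain ⟨k, C, ⟨-, hC⟩, i, hi⟩ := hC ⟨b, a, b', h.2.1.symm, hb, hbb⟩
  have hl := hC (i - 1)
  rw [sub_add_cancel, hi] at hl
  generalize C (i - 1) = Q at hl
  obtain ⟨s, t, u, hst, htu, hsu⟩ := Q
  obtain ⟨l1, l2, l3, l4⟩ := hl
  have l1 := loses_or_loses_of_adj (p := s) (q := t) (r := a) (w := b) l1 rfl Sym2.eq_swap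
  have l2 := loses_or_loses_of_adj (p := s) (q := t) (r := a) (w := b') l2 rfl rfl
  have l4 := loses_or_loses_of_adj (p := t) (q := u) (r := a) (w := b') l4 rfl rfl
  have key : ∀ {p q : V}, D.Loses p q a b' ∨ D.Loses p q b' a → D.Loses p q a b →
      D.Loses p q a b' := by
    rintro p q (h1 | h1) h2
    · exact h1
    · exact absurd (hD.adj_of_loses h1) (hD.asymm h2.2.2.1)
  rcases l1 with l1 | l1
  · obtain ⟨rfl, rfl | rfl⟩ := hD.eq_center hst htu hsu h.1
      (hD.missing_of_loses_left l1 h) (hD.missing_of_loses_left h l1)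
    · exact key l2 h
    · exact key (l4.symm.imp Loses.symm Loses.symm) h
  · have l1 := l1.symm
    obtain ⟨rfl, rfl | rfl⟩ := hD.eq_center hst htu hsu h.1.symm
      (hD.missing_of_loses_left h l1).symm (hD.missing_of_loses_left l1 h).symm
    · exact key (l2.symm.imp Loses.symm Loses.symm) h
    · exact key l4 h

end MissesShortPaths

end Digraph

namespace Digraph

variable {V : Type u} {D : Digraph V}

open Relation

/-- `b` follows `x`: a missing edge `xy` loses to a missing edge `ab`, with `x → a`. -/
def Follows (D : Digraph V) (x b : V) : Prop := ∃ y a, D.Loses x y a b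

/-- `x` lies on a cycle of the relation `Follows`. -/
def Cyclic (D : Digraph V) (x : V) : Prop := TransGen D.Follows x x

/-- Two vertices in the same connected component of the missing graph. -/
def Near (D : Digraph V) (v w : V) : Prop :=
  v = w ∨ D.missingGraph.Adj v w ∨ ∃ z, D.missingGraph.Adj v z ∧ D.missingGraph.Adj z w

/-- A vertex that does not dominate a vertex with which it shares a missing neighbor. -/
def Sink (D : Digraph V) (v : V) : Prop :=
  ∀ z w, D.missingGraph.Adj v z → D.missingGraph.Adj z w → ¬ D.Adj v w

/-- The losing relation does not distinguish the two ends of a missing path of length two. -/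
structure Tame (D : Digraph V) : Prop extends D.MissesShortPaths where
  congr_snd : ∀ {x y y' a b}, D.Loses x y a b → D.missingGraph.Adj x y' → D.Loses x y' a b
  congr_fourth : ∀ {x y a b b'}, D.Loses x y a b → D.missingGraph.Adj a b' → D.Loses x y a b'

lemma MissesShortPaths.tame (hD : D.MissesShortPaths) (hC : D.PathsFormDoubleCycles) : D.Tame :=
  { hD with congr_snd := hD.loses_congr_snd hC, congr_fourth := hD.loses_congr_fourth hC }

variable {x y z w a b x' b' u v s : V}

lemma Follows.exists_left (h : D.Follows x b) : ∃ y, D.missingGraph.Adj x y :=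
  let ⟨y, _, h⟩ := h; ⟨y, h.1⟩

lemma Follows.exists_right (h : D.Follows x b) : ∃ a, D.missingGraph.Adj a b :=
  let ⟨_, a, h⟩ := h; ⟨a, h.2.1⟩

namespace Tame

lemma loses (hD : D.Tame) (h : D.Follows x b) (hy : D.missingGraph.Adj x y)
    (ha : D.missingGraph.Adj a b) : D.Loses x y a b := by
  obtain ⟨y0, a0, h⟩ := h
  exact (hD.congr_fourth (hD.congr_snd h hy).symm ha.symm).symm

lemma adj (hD : D.Tame) (h : D.Follows x b) : D.Adj b x :=
  let ⟨_, _, h⟩ := h; hD.adj_of_loses h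

lemma not_adj (hD : D.Tame) (h : D.Follows x b) (hv : D.Adj x v) : ¬ D.Adj v b :=
  let ⟨_, _, h⟩ := h; hD.not_adj_of_loses h hv

lemma opp (hD : D.Tame) (h : D.Follows x b) (hy : D.missingGraph.Adj x y)
    (ha : D.missingGraph.Adj a b) : D.Follows y a :=
  ⟨x, b, (hD.loses h hy ha).symm⟩

lemma fwd (hD : D.Tame) (h : D.Follows x b) (ha : D.missingGraph.Adj a b) : D.Adj x a :=
  let ⟨_, hy⟩ := h.exists_left
  (hD.loses h hy ha).2.2.1

lemma congr_right (hD : D.Tame) (h : D.Follows x b) (hz : D.missingGraph.Adj b z)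
    (hb' : D.missingGraph.Adj z b') : D.Follows x b' :=
  let ⟨_, hy⟩ := h.exists_left
  hD.opp (hD.opp h hy hz.symm) hy.symm hb'.symm

lemma right_unique (hD : D.Tame) (h : D.Follows x b) (h' : D.Follows x b') :
    ∃ z, D.missingGraph.Adj b z ∧ D.missingGraph.Adj z b' := by
  obtain ⟨y, hy⟩ := h.exists_left
  obtain ⟨a, ha⟩ := h.exists_right
  obtain ⟨a', ha'⟩ := h'.exists_right
  exact ⟨a, ha.symm, hD.missing_of_loses_right (hD.loses h hy ha) (hD.loses h' hy ha')⟩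

lemma left_unique (hD : D.Tame) (h : D.Follows x b) (h' : D.Follows x' b) :
    ∃ z, D.missingGraph.Adj x z ∧ D.missingGraph.Adj z x' := by
  obtain ⟨y, hy⟩ := h.exists_left
  obtain ⟨a, ha⟩ := h.exists_right
  obtain ⟨y', hy'⟩ := h'.exists_left
  exact ⟨y', hD.missing_of_loses_left (hD.loses h hy ha) (hD.loses h' hy' ha), hy'.symm⟩

lemma transGen_exists_right (h : TransGen D.Follows x w) :
    ∃ a, D.missingGraph.Adj a w := by
  obtain ⟨_, _, h⟩ := TransGen.tail'_iff.1 h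
  exact h.exists_right

lemma transGen_exists_left (h : TransGen D.Follows x w) :
    ∃ y, D.missingGraph.Adj x y := by
  obtain ⟨_, h, _⟩ := TransGen.head'_iff.1 h
  exact h.exists_left

lemma transGen_opp (hD : D.Tame) (h : TransGen D.Follows x w) (hy : D.missingGraph.Adj x y)
    (hz : D.missingGraph.Adj z w) : TransGen D.Follows y z := by
  induction h generalizing z with
  | single h => exact .single (hD.opp h hy hz)
  | tail _ h ih =>
    obtain ⟨w', hw'⟩ := h.exists_left
    exact (ih hw'.symm).tail (hD.opp h hw' hz)

lemma transGen_congr_left (hD : D.Tame) (h : TransGen D.Follows x w)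
    (hz : D.missingGraph.Adj x z) (hx' : D.missingGraph.Adj z x') : TransGen D.Follows x' w :=
  let ⟨_, ha⟩ := transGen_exists_right h
  hD.transGen_opp (hD.transGen_opp h hz ha) hx' ha.symm

lemma transGen_congr_right (hD : D.Tame) (h : TransGen D.Follows x b)
    (hz : D.missingGraph.Adj b z) (hb' : D.missingGraph.Adj z b') : TransGen D.Follows x b' :=
  let ⟨_, hy⟩ := transGen_exists_left h
  hD.transGen_opp (hD.transGen_opp h hy hz.symm) hy.symm hb'.symm

lemma cyclic_of_opp (hD : D.Tame) (h : TransGen D.Follows x y) (hxy : D.missingGraph.Adj x y) :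
    D.Cyclic x :=
  h.trans (hD.transGen_opp h hxy hxy)

lemma cyclic_opp (hD : D.Tame) (h : D.Cyclic x) (hxy : D.missingGraph.Adj x y) : D.Cyclic y :=
  hD.transGen_opp h hxy hxy.symm

lemma adj_or_exists_opp (hD : D.Tame) (h : TransGen D.Follows x w) :
    D.Adj w x ∨ ∃ y, D.missingGraph.Adj x y ∧ TransGen D.Follows x y := by
  induction h with
  | single h => exact Or.inl (hD.adj h)
  | @tail c b hc h ih =>
    rcases ih with ih | ih
    · by_cases hm : D.missingGraph.Adj x b
      · exact Or.inr ⟨b, hm, hc.tail h⟩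
      · left
        have hne : x ≠ b := by
          rintro rfl
          exact hD.asymm (hD.adj h) ih
        exact (adj_or_adj hne hm).resolve_left (hD.not_adj h ih)
    · exact Or.inr ih

lemma exists_opp_of_cyclic (hD : D.Tame) (h : D.Cyclic x) :
    ∃ y, D.missingGraph.Adj x y ∧ TransGen D.Follows x y :=
  (hD.adj_or_exists_opp h).resolve_left (hD.irrefl x)

/-- Each vertex reached from a cyclic vertex `x` reaches `x`. -/
lemma reach_symm (hD : D.Tame) (hx : D.Cyclic x) (h : ReflTransGen D.Follows x w) :
    TransGen D.Follows w x := by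
  induction h with
  | refl => exact hx
  | @tail c b _ h ih =>
    obtain ⟨d, hcd, hd⟩ := TransGen.head'_iff.1 ih
    obtain ⟨z, hz, hz'⟩ := hD.right_unique h hcd
    rcases reflTransGen_iff_eq_or_transGen.1 hd with rfl | hd
    · exact hD.transGen_congr_left hx hz'.symm hz.symm
    · exact hD.transGen_congr_left hd hz'.symm hz.symm

lemma cyclic_of_reach (hD : D.Tame) (hx : D.Cyclic x) (h : ReflTransGen D.Follows x w) :
    D.Cyclic w :=
  (hD.reach_symm hx h).trans_left h

lemma reach_opp (hD : D.Tame) (hx : D.Cyclic x) (h : ReflTransGen D.Follows x w)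
    (hw : D.missingGraph.Adj w y) : ReflTransGen D.Follows x y := by
  obtain ⟨y', h1, h2⟩ := hD.exists_opp_of_cyclic (hD.cyclic_of_reach hx h)
  exact h.trans (hD.transGen_congr_right h2 h1.symm hw).to_reflTransGen

lemma adj_of_reach (hD : D.Tame) (hx : D.Cyclic x) (hv : ¬ ReflTransGen D.Follows x v)
    (h : D.Adj x v) (hw : ReflTransGen D.Follows x w) : D.Adj w v := by
  induction hw with
  | refl => exact h
  | @tail c b hc hb ih =>
    have hxb := hc.tail hb
    refine (adj_or_adj ?_ ?_).resolve_right (hD.not_adj hb ih)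
    · rintro rfl
      exact hv hxb
    · intro hm
      exact hv (hD.reach_opp hx hxb hm)

/-- The vertices reached from a cyclic vertex form an interval: they have the same outside
out-neighbors. -/
lemma adj_left_iff (hD : D.Tame) (hx : D.Cyclic x) (hv : ¬ ReflTransGen D.Follows x v)
    (hw : ReflTransGen D.Follows x w) : D.Adj w v ↔ D.Adj x v := by
  refine ⟨fun h => ?_, fun h => hD.adj_of_reach hx hv h hw⟩
  exact hD.adj_of_reach (hD.cyclic_of_reach hx hw) (fun h' => hv (hw.trans h')) h
    (hD.reach_symm hx hw).to_reflTransGen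

lemma adj_right_iff (hD : D.Tame) (hx : D.Cyclic x) (hv : ¬ ReflTransGen D.Follows x v)
    (hw : ReflTransGen D.Follows x w) : D.Adj v w ↔ D.Adj v x := by
  have key : ∀ {u}, ReflTransGen D.Follows x u → (D.Adj v u ↔ ¬ D.Adj u v) := by
    intro u hu
    refine ⟨hD.asymm, fun h => (adj_or_adj ?_ ?_).resolve_left h⟩
    · rintro rfl; exact hv hu
    · exact fun h' => hv (hD.reach_opp hx hu h')
  rw [key hw, key .refl, hD.adj_left_iff hx hv hw]

/-- The ends of a missing edge do not both dominate a vertex that can be reached from them. -/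
lemma not_adj_of_adj_opp (hD : D.Tame) (h : ReflTransGen D.Follows w v)
    (hy : D.missingGraph.Adj w y) (hw : D.Adj w v) : ¬ D.Adj y v := by
  intro hyv
  have key : ∀ u, ReflTransGen D.Follows w u →
      D.Adj u v ∧ ∃ a, D.missingGraph.Adj u a ∧ D.Adj a v := by
    intro u hu
    induction hu with
    | refl => exact ⟨hw, y, hy, hyv⟩
    | @tail c b _ hb ih =>
      obtain ⟨h1, a, hca, h2⟩ := ih
      obtain ⟨d, hd⟩ := hb.exists_right
      have hopp := hD.opp hb hca hd
      refine ⟨(adj_or_adj ?_ ?_).resolve_right (hD.not_adj hb h1), d, hd.symm,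
        (adj_or_adj ?_ ?_).resolve_right (hD.not_adj hopp h2)⟩
      · rintro rfl
        exact hD.asymm h1 (hD.adj hb)
      · intro hm
        exact hD.asymm h2 (hD.adj (hD.opp hb hca hm.symm))
      · rintro rfl
        exact hD.asymm h2 (hD.adj hopp)
      · intro hm
        exact hD.asymm h1 (hD.adj (hD.congr_right hb hd.symm hm))
  exact hD.irrefl v (key v h).1

end Tame

lemma Near.symm (h : D.Near v w) : D.Near w v := by
  rcases h with h | h | ⟨z, h1, h2⟩
  · exact Or.inl h.symm
  · exact Or.inr (Or.inl h.symm)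
  · exact Or.inr (Or.inr ⟨z, h2.symm, h1.symm⟩)

lemma MissesShortPaths.near_right (hD : D.MissesShortPaths) (h : D.Near v w)
    (hy : D.missingGraph.Adj w y) : D.Near v y := by
  rcases h with rfl | h | ⟨z, h1, h2⟩
  · exact Or.inr (Or.inl hy)
  · exact Or.inr (Or.inr ⟨w, h, hy⟩)
  · rcases hD.eq_or_eq h1 h2 hy with rfl | rfl
    · exact Or.inr (Or.inl hy)
    · exact Or.inr (Or.inl h1)

lemma adj_or_adj_of_not_near (h : ¬ D.Near v w) : D.Adj v w ∨ D.Adj w v :=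
  adj_or_adj (fun e => h (Or.inl e)) (fun e => h (Or.inr (Or.inl e)))

lemma MissesShortPaths.sink_unique (hD : D.MissesShortPaths) (h : D.missingGraph.Adj y s)
    (h' : D.missingGraph.Adj y w) (hs : D.Sink s) (hw : D.Sink w) : s = w := by
  by_contra hne
  rcases adj_or_adj hne (hD.no_triangle h.symm h') with h1 | h1
  · exact hs y w h.symm h' h1
  · exact hw y s h'.symm h h1

lemma MissesShortPaths.exists_sink (hD : D.MissesShortPaths) (h : D.missingGraph.Adj y x) :
    ∃ s, D.missingGraph.Adj y s ∧ D.Sink s := by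
  by_cases hx : D.Sink x
  · exact ⟨x, h, hx⟩
  · simp only [Sink, not_forall, not_not] at hx
    obtain ⟨z, w, h1, h2, h3⟩ := hx
    have hz : y = z := (hD.eq_or_eq h h1 h2).resolve_right (hD.ne h3)
    subst hz
    refine ⟨w, h2, fun z' u h4 h5 h6 => ?_⟩
    have hz' : y = z' := (hD.eq_or_eq h2 h4 h5).resolve_right (hD.ne h6)
    subst hz'
    rcases hD.degree_le_two h h2 h5 with e | e | e
    · exact hD.ne h3 e
    · exact hD.ne h6 e
    · subst e; exact hD.asymm h3 h6

namespace Tame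

/-- In an interval, `w` dominates `v` iff `v` dominates the missing neighbors of `w`. -/
lemma adj_iff_adj_opp (hD : D.Tame) (hw : D.Cyclic w) (h : ReflTransGen D.Follows w v)
    (hy : D.missingGraph.Adj w y) (hn : ¬ D.Near v w) : D.Adj w v ↔ D.Adj v y := by
  have hny : ¬ D.Near v y := fun h' => hn (hD.near_right h' hy.symm)
  constructor
  · exact fun h1 => (adj_or_adj_of_not_near hny).resolve_right (hD.not_adj_of_adj_opp h hy h1)
  · intro h1
    refine (adj_or_adj_of_not_near hn).resolve_left fun h2 => ?_
    have hv := hD.cyclic_of_reach hw h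
    have hvw := (hD.reach_symm hw h).to_reflTransGen
    have hvy := hvw.trans (hD.reach_opp hw .refl hy)
    obtain ⟨v', hv', -⟩ := hD.exists_opp_of_cyclic hv
    have hnv : ∀ {t}, ¬ D.Near v t → ¬ D.Near t v' := fun ht h' =>
      ht (hD.near_right h' hv'.symm).symm
    have h3 := (adj_or_adj_of_not_near (hnv hn)).resolve_right (hD.not_adj_of_adj_opp hvw hv' h2)
    have h4 := (adj_or_adj_of_not_near (hnv hny)).resolve_right
      (hD.not_adj_of_adj_opp hvy hv' h1)
    exact hD.not_adj_of_adj_opp (hD.reach_opp hw h hv') hy h3 h4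

open Classical in
/-- The sinks that a vertex of an interval dominates are as many as those that dominate it. -/
lemma card_sinks [Fintype V] (hD : D.Tame) (hx : D.Cyclic x) (hu : ReflTransGen D.Follows x u) :
    2 * (Finset.univ.filter fun v => (ReflTransGen D.Follows x v ∧ D.Sink v) ∧
        D.Adj v u ∧ ¬ D.Near v u).card + 2 =
      (Finset.univ.filter fun v => ReflTransGen D.Follows x v ∧ D.Sink v).card ∧
    2 * (Finset.univ.filter fun v => (ReflTransGen D.Follows x v ∧ D.Sink v) ∧
        D.Adj u v ∧ ¬ D.Near v u).card + 2 =
      (Finset.univ.filter fun v => ReflTransGen D.Follows x v ∧ D.Sink v).card := by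
  have hopp : ∀ v, ReflTransGen D.Follows x v → ∃ s, D.missingGraph.Adj v s ∧ D.Sink s := by
    intro v hv
    obtain ⟨y, hy, -⟩ := hD.exists_opp_of_cyclic (hD.cyclic_of_reach hx hv)
    exact hD.exists_sink hy
  choose! o ho ho' using hopp
  have hoK : ∀ v, ReflTransGen D.Follows x v → ReflTransGen D.Follows x (o v) :=
    fun v hv => hD.reach_opp hx hv (ho v hv)
  have hoo : ∀ v, ReflTransGen D.Follows x v → D.Sink v → o (o v) = v := fun v hv hs =>
    hD.sink_unique (ho _ (hoK v hv)) (ho v hv).symm (ho' _ (hoK v hv)) hs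
  have hvu : ∀ {v w}, ReflTransGen D.Follows x v → ReflTransGen D.Follows x w →
      ReflTransGen D.Follows v w := fun hv hw => (hD.reach_symm hx hv).to_reflTransGen.trans hw
  have hbij : (Finset.univ.filter fun v => (ReflTransGen D.Follows x v ∧ D.Sink v) ∧
        D.Adj v u ∧ ¬ D.Near v u).card =
      (Finset.univ.filter fun v => (ReflTransGen D.Follows x v ∧ D.Sink v) ∧
        D.Adj u v ∧ ¬ D.Near v u).card := by
    refine Finset.card_nbij' o o ?_ ?_ ?_ ?_
    · intro v hv
      simp only [Finset.coe_filter, Finset.mem_univ, true_and, Set.mem_ofPred_eq] at hv ⊢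
      obtain ⟨⟨h1, h2⟩, h3, h4⟩ := hv
      exact ⟨⟨hoK v h1, ho' v h1⟩, (hD.adj_iff_adj_opp (hD.cyclic_of_reach hx h1) (hvu h1 hu)
        (ho v h1) fun h => h4 h.symm).1 h3,
        fun h => h4 (hD.near_right h.symm (ho v h1).symm).symm⟩
    · intro v hv
      simp only [Finset.coe_filter, Finset.mem_univ, true_and, Set.mem_ofPred_eq] at hv ⊢
      obtain ⟨⟨h1, h2⟩, h3, h4⟩ := hv
      have h5 : ¬ D.Near (o v) u := fun h => h4 (hD.near_right h.symm (ho v h1).symm).symm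
      exact ⟨⟨hoK v h1, ho' v h1⟩, (hD.adj_iff_adj_opp (hD.cyclic_of_reach hx (hoK v h1))
        (hvu (hoK v h1) hu) (ho v h1).symm fun h => h5 h.symm).2 h3, h5⟩
    · intro v hv
      simp only [Finset.coe_filter, Finset.mem_univ, true_and, Set.mem_ofPred_eq] at hv
      exact hoo v hv.1.1 hv.1.2
    · intro v hv
      simp only [Finset.coe_filter, Finset.mem_univ, true_and, Set.mem_ofPred_eq] at hv
      exact hoo v hv.1.1 hv.1.2
  have hnear : (Finset.univ.filter fun v => ReflTransGen D.Follows x v ∧ D.Sink v).filter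
      (fun v => D.Near v u) = {o u, o (o u)} := by
    have h1 := ho u hu
    have h2 := ho _ (hoK u hu)
    ext v
    simp only [Finset.mem_filter, Finset.mem_univ, true_and, Finset.mem_insert,
      Finset.mem_singleton]
    constructor
    · rintro ⟨⟨hv, hs⟩, hn⟩
      have h3 : D.missingGraph.Adj u v ∨ D.missingGraph.Adj (o u) v := by
        rcases hn with rfl | hn | ⟨z, h3, h4⟩
        · exact Or.inr h1.symm
        · exact Or.inl hn.symm
        · rcases hD.eq_or_eq h3 h4 h1 with rfl | rfl
          · exact Or.inr h1.symm
          · exact Or.inr h3.symm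
      exact h3.imp (fun h => hD.sink_unique h h1 hs (ho' u hu))
        (fun h => hD.sink_unique h h2 hs (ho' _ (hoK u hu)))
    · rintro (rfl | rfl)
      · exact ⟨⟨hoK u hu, ho' u hu⟩, Or.inr (Or.inl h1.symm)⟩
      · exact ⟨⟨hoK _ (hoK u hu), ho' _ (hoK u hu)⟩, Or.inr (Or.inr ⟨o u, h2.symm, h1.symm⟩)⟩
  have hne : o u ≠ o (o u) := (ho _ (hoK u hu)).1
  have hcard := congrArg Finset.card hnear
  rw [Finset.card_pair hne] at hcard
  have hsplit := Finset.card_filter_add_card_filter_not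
    (s := Finset.univ.filter fun v => ReflTransGen D.Follows x v ∧ D.Sink v)
    (fun v => D.Near v u)
  have hsplit' := Finset.card_filter_add_card_filter_not
    (s := (Finset.univ.filter fun v => ReflTransGen D.Follows x v ∧ D.Sink v).filter
      fun v => ¬ D.Near v u) (fun v => D.Adj v u)
  have e1 : (((Finset.univ.filter fun v => ReflTransGen D.Follows x v ∧ D.Sink v).filter
      fun v => ¬ D.Near v u).filter fun v => D.Adj v u) =
      Finset.univ.filter fun v => (ReflTransGen D.Follows x v ∧ D.Sink v) ∧
        D.Adj v u ∧ ¬ D.Near v u := by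
    ext v; simp only [Finset.mem_filter, Finset.mem_univ, true_and]; tauto
  have e2 : (((Finset.univ.filter fun v => ReflTransGen D.Follows x v ∧ D.Sink v).filter
      fun v => ¬ D.Near v u).filter fun v => ¬ D.Adj v u) =
      Finset.univ.filter fun v => (ReflTransGen D.Follows x v ∧ D.Sink v) ∧
        D.Adj u v ∧ ¬ D.Near v u := by
    ext v; simp only [Finset.mem_filter, Finset.mem_univ, true_and]
    constructor
    · rintro ⟨⟨h1, h2⟩, h3⟩
      exact ⟨h1, (adj_or_adj_of_not_near h2).resolve_left h3, h2⟩
    · rintro ⟨h1, h2, h3⟩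
      exact ⟨⟨h1, h3⟩, hD.asymm h2⟩
  rw [e1, e2] at hsplit'
  omega

lemma mem_secondOutNbhd (hD : D.Tame) (hw : D.Cyclic w) (hv : ReflTransGen D.Follows w v)
    (hb : D.Follows w b) (h : D.Adj w v) (hn : ¬ D.Near v w) : b ∈ D.secondOutNbhd v := by
  obtain ⟨y, hy⟩ := hb.exists_left
  obtain ⟨a, ha⟩ := hb.exists_right
  have h1 := (hD.adj_iff_adj_opp hw hv hy hn).1 h
  have h2 := hD.fwd (hD.opp hb hy ha) ha.symm
  refine ⟨?_, hD.not_adj hb h, y, h1, h2⟩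
  rintro rfl
  exact hD.asymm h1 h2

open Classical in
/-- Some vertex of an interval has the second neighborhood property inside the interval. -/
theorem exists_interval_snp [Fintype V] (hD : D.Tame) (hx : D.Cyclic x) :
    ∃ f, ReflTransGen D.Follows x f ∧
      (Finset.univ.filter fun u => ReflTransGen D.Follows x u ∧ D.Adj f u).card ≤
      (Finset.univ.filter fun u => ReflTransGen D.Follows x u ∧ u ∈ D.secondOutNbhd f).card := by
  let K := Finset.univ.filter fun v => ReflTransGen D.Follows x v
  let R := Finset.univ.filter fun v => ReflTransGen D.Follows x v ∧ D.Sink v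
  have hR : R.Nonempty := by
    obtain ⟨y, hy, -⟩ := hD.exists_opp_of_cyclic hx
    obtain ⟨s, hs, hs'⟩ := hD.exists_sink hy
    exact ⟨s, Finset.mem_filter.2 ⟨Finset.mem_univ _, hD.reach_opp hx .refl hs, hs'⟩⟩
  have hsum : ∑ f ∈ R, (K.filter fun u => D.Adj f u).card ≤
      ∑ f ∈ R, (K.filter fun u => u ∈ D.secondOutNbhd f).card := by
    have e1 := Finset.sum_card_bipartiteAbove_eq_sum_card_bipartiteBelow (s := R) (t := K)
      (fun f u => D.Adj f u)
    have e2 := Finset.sum_card_bipartiteAbove_eq_sum_card_bipartiteBelow (s := R) (t := K)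
      (fun f u => u ∈ D.secondOutNbhd f)
    simp only [Finset.bipartiteAbove, Finset.bipartiteBelow] at e1 e2
    rw [e1, e2]
    refine Finset.sum_le_sum fun u hu => ?_
    have hu : ReflTransGen D.Follows x u := (Finset.mem_filter.1 hu).2
    obtain ⟨w, hw, hwu⟩ := TransGen.tail'_iff.1 (hD.cyclic_of_reach hx hu)
    have hw := hu.trans hw
    have c1 := (hD.card_sinks hx hu).1
    have c2 := (hD.card_sinks hx hw).2
    calc (R.filter fun f => D.Adj f u).card
        ≤ (Finset.univ.filter fun v => (ReflTransGen D.Follows x v ∧ D.Sink v) ∧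
          D.Adj v u ∧ ¬ D.Near v u).card := by
          refine Finset.card_le_card fun f hf => ?_
          simp only [R, Finset.mem_filter, Finset.mem_univ, true_and] at hf ⊢
          refine ⟨hf.1, hf.2, ?_⟩
          rintro (h | h | ⟨z, h1, h2⟩)
          · exact hD.ne hf.2 h
          · exact hD.not_missing hf.2 h
          · exact hf.1.2 z u h1 h2 hf.2
      _ = (Finset.univ.filter fun v => (ReflTransGen D.Follows x v ∧ D.Sink v) ∧
          D.Adj w v ∧ ¬ D.Near v w).card := by omega
      _ ≤ (R.filter fun f => u ∈ D.secondOutNbhd f).card := by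
          refine Finset.card_le_card fun f hf => ?_
          simp only [R, Finset.mem_filter, Finset.mem_univ, true_and] at hf ⊢
          exact ⟨hf.1, hD.mem_secondOutNbhd (hD.cyclic_of_reach hx hw)
            ((hD.reach_symm hx hw).to_reflTransGen.trans hf.1.1) hwu hf.2.1 hf.2.2⟩
  obtain ⟨f, hf, hle⟩ := Finset.exists_le_of_sum_le hR hsum
  refine ⟨f, (Finset.mem_filter.1 hf).2.1, ?_⟩
  simpa only [K, Finset.filter_filter] using hle

end Tame

end Digraph

namespace Digraph

variable {V : Type u} {D : Digraph V}

open Relation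

lemma MissingPathTwo.LosesTo.exists_follows {P Q : D.MissingPathTwo} (h : P.LosesTo Q) {x : V}
    (hx : x ∈ P.verts) : ∃ w ∈ Q.verts, D.Follows x w := by
  have hs : Q.a ∈ Q.verts := Or.inl rfl
  have ht : Q.b ∈ Q.verts := Or.inr (Or.inl rfl)
  have h1 := loses_or_loses_of_adj (p := P.a) (q := P.b) (r := Q.a) (w := Q.b) h.1 rfl rfl
  have h3 := loses_or_loses_of_adj (p := P.b) (q := P.c) (r := Q.a) (w := Q.b) h.2.2.1 rfl rfl
  rcases hx with rfl | rfl | rfl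
  · rcases h1 with h1 | h1
    · exact ⟨_, ht, _, _, h1⟩
    · exact ⟨_, hs, _, _, h1⟩
  · rcases h3 with h3 | h3
    · exact ⟨_, ht, _, _, h3⟩
    · exact ⟨_, hs, _, _, h3⟩
  · rcases h3 with h3 | h3
    · exact ⟨_, hs, _, _, h3.symm⟩
    · exact ⟨_, ht, _, _, h3.symm⟩

variable {x y z a b : V}

/-- The ends of the missing paths of length two are cyclic. -/
lemma Tame.cyclic_of_ne (hD : D.Tame) (hC : D.PathsFormDoubleCycles)
    (hxy : D.missingGraph.Adj x y) (hyz : D.missingGraph.Adj y z) (hxz : x ≠ z) :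
    D.Cyclic x := by
  obtain ⟨k, C, ⟨-, hC⟩, i, hi⟩ := hC ⟨x, y, z, hxy, hyz, hxz⟩
  have key : ∀ n : ℕ, ∃ w ∈ (C (i + (n + 1) • 1)).verts,
      TransGen D.Follows x w := by
    intro n
    induction n with
    | zero =>
      have hl := hC i
      have hx : x ∈ (C i).verts := by rw [hi]; exact Or.inl rfl
      obtain ⟨w, hw, h⟩ := hl.exists_follows hx
      exact ⟨w, by simpa using hw, .single h⟩
    | succ n ih =>
      obtain ⟨c, hc, h⟩ := ih
      obtain ⟨w, hw, h'⟩ := (hC _).exists_follows hc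
      refine ⟨w, ?_, h.tail h'⟩
      rw [succ_nsmul, ← add_assoc]
      exact hw
  obtain ⟨w, hw, h⟩ := key k
  have hk : (k + 1) • (1 : Fin (k + 1)) = 0 := by
    simpa using card_nsmul_eq_zero (x := (1 : Fin (k + 1)))
  rw [hk, add_zero, hi] at hw
  rcases hw with rfl | rfl | rfl
  · exact h
  · exact hD.cyclic_of_opp h hxy
  · exact hD.transGen_congr_right h hyz.symm hxy.symm

/-- The completion of the missing edge `ab` by the arc `(a, b)` creates no second out-neighbor
that passes through it. -/
def GoodArc (D : Digraph V) (a b : V) : Prop :=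
  ∀ v, D.Adj v a → b ∈ D.outNbhd v ∪ D.secondOutNbhd v

lemma MissesShortPaths.goodArc_or (hD : D.MissesShortPaths) (hab : D.missingGraph.Adj a b)
    (hs : ∀ x, ¬ D.Follows x b) : D.GoodArc a b ∨ D.GoodArc b a := by
  by_contra hcon
  simp only [GoodArc, not_or, not_forall] at hcon
  obtain ⟨⟨v, hv, hvb⟩, w, hw, hwa⟩ := hcon
  refine hs v ⟨w, a, ⟨?_, fun h => ?_, fun h => ?_⟩, hab, hv, hvb, hw, hwa⟩
  · rintro rfl
    exact hvb (Or.inl hw)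
  · refine hvb (Or.inr ⟨?_, fun h' => hvb (Or.inl h'), w, h, hw⟩)
    rintro rfl
    exact hD.not_missing hv hab.symm
  · refine hwa (Or.inr ⟨?_, fun h' => hwa (Or.inl h'), v, h, hv⟩)
    rintro rfl
    exact hD.not_missing hw hab

lemma Tame.eq_of_missing (hD : D.Tame) (hC : D.PathsFormDoubleCycles) (hx : ¬ D.Cyclic x)
    (hy : D.missingGraph.Adj x y) (hz : D.missingGraph.Adj x z) : y = z := by
  by_contra hne
  exact hx (hD.cyclic_opp (hD.cyclic_of_ne hC hy.symm hz hne) hy.symm)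

lemma Tame.cyclic_of_follows (hD : D.Tame) (hx : D.Cyclic x) (h : D.Follows x b) : D.Cyclic b :=
  hD.cyclic_of_reach hx (.single h)

lemma Tame.cyclic_of_follows' (hD : D.Tame) (hb : D.Cyclic b) (h : D.Follows x b) :
    D.Cyclic x := by
  obtain ⟨c, hbc, hcb⟩ := TransGen.tail'_iff.1 hb
  obtain ⟨z, h1, h2⟩ := hD.left_unique hcb h
  exact hD.cyclic_opp (hD.cyclic_opp (hD.cyclic_of_reach hb hbc) h1) h2

lemma Tame.left_unique_of_not_cyclic (hD : D.Tame) (hC : D.PathsFormDoubleCycles)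
    (hb : ¬ D.Cyclic b) (h : D.Follows x b) (h' : D.Follows y b) : x = y := by
  by_contra hne
  obtain ⟨z, h1, h2⟩ := hD.left_unique h h'
  exact hb (hD.cyclic_of_follows (hD.cyclic_of_ne hC h1 h2 hne) h)

/-- The missing edges outside the cycles of the dependency digraph can be oriented consistently
with the losing relation, and starting with good arcs: `τ` selects the tails. -/
theorem Tame.exists_tails [Finite V] (hD : D.Tame) (hC : D.PathsFormDoubleCycles) :
    ∃ τ : V → Prop, (∀ x b, ¬ D.Cyclic b → D.Follows x b → (τ b ↔ ¬ τ x)) ∧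
      (∀ x y, ¬ D.Cyclic x → D.missingGraph.Adj x y → (τ x ↔ ¬ τ y)) ∧
      ∀ a b, ¬ D.Cyclic a → D.missingGraph.Adj a b → (∀ x, ¬ D.Follows x b) → τ a →
        D.GoodArc a b := by
  classical
  obtain ⟨n, ⟨e⟩⟩ := Finite.exists_equiv_fin V
  let S : V → Prop := fun a =>
    ∃ b, D.missingGraph.Adj a b ∧ D.GoodArc a b ∧ (¬ D.GoodArc b a ∨ e a < e b)
  let r : V → V → Prop := fun u v => TransGen D.Follows u v ∧ ¬ D.Cyclic v
  have : IsTrans V r := ⟨fun _ _ _ h1 h2 => ⟨h1.1.trans h2.1, h2.2⟩⟩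
  have : Std.Irrefl r := ⟨fun _ h => h.2 h.1⟩
  have hwf : WellFounded r := Finite.wellFounded_of_trans_of_irrefl r
  let F : (v : V) → ((u : V) → r u v → Prop) → Prop := fun v ih =>
    if h : ¬ D.Cyclic v ∧ ∃ x, D.Follows x v then
      ¬ ih h.2.choose ⟨.single h.2.choose_spec, h.1⟩ else S v
  let τ : V → Prop := hwf.fix F
  have hτ : ∀ v, τ v = F v fun u _ => τ u := fun v => hwf.fix_eq F v
  have h1 : ∀ x b, ¬ D.Cyclic b → D.Follows x b → (τ b ↔ ¬ τ x) := by
    intro x b hb hx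
    have h : ¬ D.Cyclic b ∧ ∃ x, D.Follows x b := ⟨hb, x, hx⟩
    rw [hτ b]
    simp only [F, dif_pos h]
    rw [hD.left_unique_of_not_cyclic hC hb hx h.2.choose_spec]
  have h2 : ∀ b, (∀ x, ¬ D.Follows x b) → (τ b ↔ S b) := by
    intro b hb
    rw [hτ b]
    simp only [F]
    rw [dif_neg (by rintro ⟨-, x, hx⟩; exact hb x hx)]
  have hS : ∀ a b, ¬ D.Cyclic a → D.missingGraph.Adj a b →
      (S a ↔ D.GoodArc a b ∧ (¬ D.GoodArc b a ∨ e a < e b)) := by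
    intro a b ha hab
    constructor
    · rintro ⟨c, hac, h⟩
      rwa [hD.eq_of_missing hC ha hab hac]
    · exact fun h => ⟨b, hab, h⟩
  have hopp : ∀ {a b}, D.missingGraph.Adj a b → (∀ x, ¬ D.Follows x b) → ∀ x, ¬ D.Follows x a := by
    intro a b hab h x hx
    obtain ⟨y, hy⟩ := hx.exists_left
    exact h y (hD.opp hx hy hab.symm)
  refine ⟨τ, h1, fun x => ?_, ?_⟩
  · induction x using hwf.induction with
    | _ x ih =>
      intro y hx hxy
      have hy : ¬ D.Cyclic y := fun h => hx (hD.cyclic_opp h hxy.symm)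
      by_cases hs : ∃ p, D.Follows p x
      · obtain ⟨p, hp⟩ := hs
        obtain ⟨q, hq⟩ := hp.exists_left
        rw [h1 p x hx hp, h1 q y hy (hD.opp hp hq hxy.symm),
          ih p ⟨.single hp, hx⟩ q (fun h => hx (hD.cyclic_of_follows h hp)) hq]
      · push Not at hs
        have hs' := hopp hxy.symm hs
        rw [h2 x hs, h2 y hs', hS x y hx hxy, hS y x hy hxy.symm]
        have hg := hD.goodArc_or hxy hs'
        have hne : e x < e y ∨ e y < e x := lt_or_gt_of_ne fun h => hxy.1 (e.injective h)
        have hlt : ¬ (e x < e y ∧ e y < e x) := fun h => lt_asymm h.1 h.2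
        grind
  · intro a b ha hab hs ht
    exact ((hS a b ha hab).1 ((h2 a (hopp hab hs)).1 ht)).1

end Digraph

namespace Digraph

variable {V : Type u} {D : Digraph V}

open Relation

open Classical in
/-- A choice of representatives of the intervals formed by the cyclic vertices. Each of them has
the second neighborhood property inside its interval. -/
theorem Tame.exists_representatives [Fintype V] (hD : D.Tame) :
    ∃ ρ : V → V, (∀ v, ρ (ρ v) = ρ v) ∧
      (∀ u v, ρ u ≠ ρ v → (D.Adj u v ↔ D.Adj (ρ u) (ρ v))) ∧
      (∀ u v, ¬ D.Cyclic v → ρ u = ρ v → u = v) ∧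
      (∀ u v, D.Cyclic u → D.missingGraph.Adj u v → ρ u = ρ v) ∧
      ∀ v, (Finset.univ.filter fun u => ρ u = ρ v ∧ D.Adj (ρ v) u).card ≤
        (Finset.univ.filter fun u => ρ u = ρ v ∧ u ∈ D.secondOutNbhd (ρ v)).card := by
  let s : Setoid V :=
    { r := fun u v => u = v ∨ (D.Cyclic u ∧ ReflTransGen D.Follows u v)
      iseqv :=
        { refl := fun _ => Or.inl rfl
          symm := by
            rintro u v (rfl | ⟨h1, h2⟩)
            · exact Or.inl rfl
            · exact Or.inr ⟨hD.cyclic_of_reach h1 h2, (hD.reach_symm h1 h2).to_reflTransGen⟩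
          trans := by
            rintro u v w (rfl | ⟨h1, h2⟩) (rfl | ⟨h3, h4⟩)
            · exact Or.inl rfl
            · exact Or.inr ⟨h3, h4⟩
            · exact Or.inr ⟨h1, h2⟩
            · exact Or.inr ⟨h1, h2.trans h4⟩ } }
  have hg : ∀ x, D.Cyclic x → ∃ f, ReflTransGen D.Follows x f ∧
      (Finset.univ.filter fun u => ReflTransGen D.Follows x u ∧ D.Adj f u).card ≤
      (Finset.univ.filter fun u => ReflTransGen D.Follows x u ∧ u ∈ D.secondOutNbhd f).card :=
    fun x hx => hD.exists_interval_snp hx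
  choose! g hg1 hg2 using hg
  let c : V → V := fun v => (Quotient.mk s v).out
  have hc : ∀ v, c v = v ∨ (D.Cyclic (c v) ∧ ReflTransGen D.Follows (c v) v) :=
    fun v => Quotient.exact (Quotient.out_eq (Quotient.mk s v))
  have hcc : ∀ {u v}, D.Cyclic u → ReflTransGen D.Follows u v → c u = c v := by
    intro u v h1 h2
    exact congrArg Quotient.out (Quotient.sound (s := s) (Or.inr ⟨h1, h2⟩))
  have hcyc : ∀ {v}, D.Cyclic v → D.Cyclic (c v) ∧ ReflTransGen D.Follows (c v) v := by
    intro v hv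
    rcases hc v with h | h
    · rw [h]; exact ⟨hv, .refl⟩
    · exact h
  have hncyc : ∀ {v}, ¬ D.Cyclic v → c v = v := fun {v} hv =>
    (hc v).resolve_right fun h => hv (hD.cyclic_of_reach h.1 h.2)
  let ρ : V → V := fun v => if D.Cyclic v then g (c v) else v
  have hρc : ∀ {v}, D.Cyclic v → ρ v = g (c v) := fun hv => if_pos hv
  have hρn : ∀ {v}, ¬ D.Cyclic v → ρ v = v := fun hv => if_neg hv
  have hreach : ∀ {v}, D.Cyclic v → ReflTransGen D.Follows v (ρ v) := by
    intro v hv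
    rw [hρc hv]
    obtain ⟨h1, h2⟩ := hcyc hv
    exact (hD.reach_symm h1 h2).to_reflTransGen.trans (hg1 _ h1)
  have hsame : ∀ {u v}, D.Cyclic u → ReflTransGen D.Follows u v → ρ u = ρ v := by
    intro u v h1 h2
    rw [hρc h1, hρc (hD.cyclic_of_reach h1 h2), hcc h1 h2]
  have hidem : ∀ v, ρ (ρ v) = ρ v := by
    intro v
    by_cases hv : D.Cyclic v
    · exact (hsame hv (hreach hv)).symm
    · rw [hρn hv, hρn hv]
  have hρcyc : ∀ {v}, D.Cyclic (ρ v) ↔ D.Cyclic v := by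
    intro v
    by_cases hv : D.Cyclic v
    · exact ⟨fun _ => hv, fun _ => hD.cyclic_of_reach hv (hreach hv)⟩
    · rw [hρn hv]
  have hiff : ∀ {u v}, D.Cyclic u → (ρ u = ρ v ↔ ReflTransGen D.Follows u v) := by
    intro u v hu
    refine ⟨fun h => ?_, hsame hu⟩
    have hv : D.Cyclic v := by rw [← hρcyc, ← h, hρcyc]; exact hu
    have h1 := hreach hu
    rw [h] at h1
    exact h1.trans (hD.reach_symm hv (hreach hv)).to_reflTransGen
  refine ⟨ρ, hidem, fun u v huv => ?_, fun u v hv huv => ?_, fun u v hu huv => ?_, fun v => ?_⟩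
  · have h1 : D.Adj u v ↔ D.Adj (ρ u) v := by
      by_cases hu : D.Cyclic u
      · exact (hD.adj_left_iff hu (fun h => huv (hsame hu h)) (hreach hu)).symm
      · rw [hρn hu]
    have h2 : D.Adj (ρ u) v ↔ D.Adj (ρ u) (ρ v) := by
      by_cases hv : D.Cyclic v
      · exact (hD.adj_right_iff hv (fun h => huv (by rw [hsame hv h, hidem])) (hreach hv)).symm
      · rw [hρn hv]
    exact h1.trans h2
  · have hu : ¬ D.Cyclic u := by rw [← hρcyc, huv, hρcyc]; exact hv
    rwa [hρn hu, hρn hv] at huv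
  · exact hsame hu (hD.reach_opp hu .refl huv)
  · by_cases hv : D.Cyclic v
    · obtain ⟨h1, h2⟩ := hcyc hv
      have h3 : ∀ u, ρ u = ρ v ↔ ReflTransGen D.Follows (c v) u := by
        intro u
        rw [← hsame h1 h2, ← hiff h1, eq_comm]
      simp only [h3]
      rw [hρc hv]
      exact hg2 _ h1
    · have h3 : ∀ u, ρ u = ρ v → u = v := by
        intro u h
        have hu : ¬ D.Cyclic u := by rw [← hρcyc, h, hρcyc]; exact hv
        rwa [hρn hu, hρn hv] at h
      rw [Finset.filter_false_of_mem]
      · simp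
      · rintro u - ⟨h4, h5⟩
        rw [h3 u h4, hρn hv] at h5
        exact hD.irrefl v h5

variable {f u w y b : V}

/-- In the completed digraph, a second out-neighbor that is not one of `D` follows `f`. -/
lemma Tame.mem_second_or_follows (hD : D.Tame) {τ : V → Prop}
    (h1 : ∀ x b, ¬ D.Cyclic b → D.Follows x b → (τ b ↔ ¬ τ x))
    (h2 : ∀ x y, ¬ D.Cyclic x → D.missingGraph.Adj x y → (τ x ↔ ¬ τ y))
    (h3 : ∀ a b, ¬ D.Cyclic a → D.missingGraph.Adj a b → (∀ x, ¬ D.Follows x b) → τ a →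
        D.GoodArc a b)
    (hfu : D.Adj f u) (huw : D.Adj u w ∨ (D.missingGraph.Adj u w ∧ τ u ∧ ¬ D.Cyclic u))
    (hwf : w ≠ f) (hfw : ¬ D.Adj f w) :
    w ∈ D.secondOutNbhd f ∨ (D.Follows f w ∧ τ f ∧ ¬ D.Cyclic w) := by
  by_contra hcon
  rw [not_or] at hcon
  obtain ⟨hsec, hcon⟩ := hcon
  have hfw' : w ∉ D.outNbhd f ∪ D.secondOutNbhd f := fun h => h.elim hfw hsec
  rcases huw with huw | ⟨huw, hτ, hcyc⟩
  · exact hsec ⟨hwf, hfw, u, hfu, huw⟩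
  · have hcw : ¬ D.Cyclic w := fun h => hcyc (hD.cyclic_opp h huw.symm)
    by_cases hs : ∃ x, D.Follows x w
    · obtain ⟨x, hx⟩ := hs
      obtain ⟨y, hy⟩ := hx.exists_left
      obtain ⟨-, -, l1, l2, l3, l4⟩ := hD.loses hx hy huw
      have hm : D.missingGraph.Adj f y := by
        by_contra hm
        have hne : f ≠ y := by
          rintro rfl
          exact hfw l3
        rcases adj_or_adj hne hm with h | h
        · exact hsec ⟨hwf, hfw, y, h, l3⟩
        · exact l4 (Or.inr ⟨hD.ne (hD.adj (hD.opp hx hy huw)), fun h' => l4 (Or.inl h'), f, h, hfu⟩)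
      have hfol : D.Follows f w := ⟨y, u, hm, huw, hfu, hfw', l3, l4⟩
      refine hcon ⟨hfol, ?_, hcw⟩
      have e1 := h1 f w hcw hfol
      have e2 := h2 u w hcyc huw
      tauto
    · push Not at hs
      exact hfw' (h3 u w hcyc huw hs hτ f hfu)

open Classical in
/-- The second neighborhood property of a representative, from the count of the vertices outside
its interval. -/
lemma hasSNP_of_card_le [Fintype V] {ρ : V → V}
    (hadj : ∀ u v, ρ u ≠ ρ v → (D.Adj u v ↔ D.Adj (ρ u) (ρ v)))
    (hidem : ∀ v, ρ (ρ v) = ρ v) (hf : ρ f = f)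
    (hin : (Finset.univ.filter fun u => ρ u = f ∧ D.Adj f u).card ≤
      (Finset.univ.filter fun u => ρ u = f ∧ u ∈ D.secondOutNbhd f).card)
    (hout : (Finset.univ.filter fun v => D.Adj f (ρ v)).card ≤
      (Finset.univ.filter fun v => ρ v ∈ D.secondOutNbhd f).card) : D.HasSNP f := by
  have hfv : ∀ {v}, ρ v ≠ f → (D.Adj f v ↔ D.Adj f (ρ v)) := by
    intro v hv
    rw [hadj f v (by rw [hf]; exact hv.symm), hf]
  have hN : (D.outNbhd f).ncard ≤ (Finset.univ.filter fun u => ρ u = f ∧ D.Adj f u).card +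
      (Finset.univ.filter fun v => D.Adj f (ρ v)).card := by
    refine le_trans ?_ (Finset.card_union_le _ _)
    rw [← Set.ncard_coe_finset]
    refine Set.ncard_le_ncard (fun v hv => ?_) (Set.toFinite _)
    simp only [Finset.coe_union, Finset.coe_filter, Finset.mem_univ, true_and, Set.mem_union,
      Set.mem_ofPred_eq]
    by_cases h : ρ v = f
    · exact Or.inl ⟨h, hv⟩
    · exact Or.inr ((hfv h).1 hv)
  have hN2 : (Finset.univ.filter fun u => ρ u = f ∧ u ∈ D.secondOutNbhd f).card +
      (Finset.univ.filter fun v => ρ v ∈ D.secondOutNbhd f).card ≤ (D.secondOutNbhd f).ncard := by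
    rw [← Finset.card_union_of_disjoint, ← Set.ncard_coe_finset]
    · refine Set.ncard_le_ncard (fun v hv => ?_) (Set.toFinite _)
      simp only [Finset.coe_union, Finset.coe_filter, Finset.mem_univ, true_and, Set.mem_union,
        Set.mem_ofPred_eq] at hv
      rcases hv with hv | ⟨h1, h2, u, h3, h4⟩
      · exact hv.2
      · refine ⟨fun e => h1 (by rw [e, hf]), fun h => h2 ((hfv h1).1 h), u, h3, ?_⟩
        have huv : ρ u ≠ ρ v := by
          intro e
          by_cases hu : ρ u = f
          · exact h1 (e ▸ hu)
          · exact h2 (e ▸ (hfv hu).1 h3)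
        rw [hadj u v huv]
        have := hadj u (ρ v) (by rw [hidem]; exact huv)
        rw [hidem] at this
        exact this.1 h4
    · rw [Finset.disjoint_left]
      intro v hv hv'
      exact (Finset.mem_filter.1 hv').2.1 (Finset.mem_filter.1 hv).2.1
  exact hN.trans ((Nat.add_le_add hin hout).trans hN2)

open Classical in
lemma sum_card_fiber [Fintype V] {ρ : V → V} (hidem : ∀ v, ρ (ρ v) = ρ v) (P : V → Prop)
    [DecidablePred P] :
    ∑ u ∈ Finset.univ.filter (fun u => ρ u = u) with P u,
      (Finset.univ.filter fun v => ρ v = u).card =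
    (Finset.univ.filter fun v => P (ρ v)).card := by
  rw [Finset.card_eq_sum_card_fiberwise (f := ρ)
    (t := (Finset.univ.filter (fun u => ρ u = u)).filter P)]
  · refine Finset.sum_congr rfl fun u hu => congrArg Finset.card ?_
    ext v
    simp only [Finset.mem_filter, Finset.mem_univ, true_and] at hu ⊢
    exact ⟨fun h => ⟨h ▸ hu.2, h⟩, fun h => h.2⟩
  · intro v hv
    simp only [Finset.coe_filter, Finset.mem_univ, true_and, Set.mem_ofPred_eq,
      Finset.mem_filter] at hv ⊢
    exact ⟨hidem v, hv⟩

end Digraph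

namespace Digraph

variable {V : Type u} {D : Digraph V}

open Relation

/-- The digraph `D` with the missing edges at the vertices of `τ` directed away from them. -/
def completion (D : Digraph V) (τ : V → Prop) (u v : V) : Prop :=
  D.Adj u v ∨ (D.missingGraph.Adj u v ∧ τ u)

open Classical in
/-- An oriented graph has a vertex with the second neighborhood property if it is tame
and its missing paths of length two form double cycles. -/
theorem Tame.exists_hasSNP [Finite V] [Nonempty V] (hD : D.Tame)
    (hC : D.PathsFormDoubleCycles) : ∃ v : V, D.HasSNP v := by
  have := Fintype.ofFinite V
  obtain ⟨τ, hτ1, hτ2, hτ3⟩ := hD.exists_tails hC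
  obtain ⟨ρ, hidem, hadj, hinj, hmiss, hin⟩ := hD.exists_representatives
  let S : Finset V := Finset.univ.filter fun u => ρ u = u
  let ω : V → ℕ := fun u => (Finset.univ.filter fun v => ρ v = u).card
  let T : V → V → Prop := D.completion τ
  have hS : ∀ {u}, u ∈ S ↔ ρ u = u := by simp [S]
  have hω : ∀ u ∈ S, 0 < ω u := fun u hu =>
    Finset.card_pos.2 ⟨u, Finset.mem_filter.2 ⟨Finset.mem_univ _, hS.1 hu⟩⟩
  have hncS : ∀ {u}, ¬ D.Cyclic u → u ∈ S := fun {u} hu => hS.2 (hinj _ _ hu (hidem u))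
  have hnc : ∀ {u}, u ∈ S → ∀ {v}, v ∈ S → D.missingGraph.Adj u v → ¬ D.Cyclic u := by
    intro u hu v hv huv hcyc
    have := hmiss u v hcyc huv
    rw [hS.1 hu, hS.1 hv] at this
    exact huv.1 this
  have htot : ∀ u ∈ S, ∀ v ∈ S, u ≠ v → T u v ∨ T v u := by
    intro u hu v hv hne
    by_cases hm : D.missingGraph.Adj u v
    · by_cases ht : τ u
      · exact Or.inl (Or.inr ⟨hm, ht⟩)
      · have := hτ2 u v (hnc hu hv hm) hm
        exact Or.inr (Or.inr ⟨hm.symm, by tauto⟩)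
    · exact (adj_or_adj hne hm).imp Or.inl Or.inl
  have hasymm : ∀ u ∈ S, ∀ v ∈ S, T u v → ¬ T v u := by
    rintro u hu v hv (h1 | ⟨h1, h2⟩) (h3 | ⟨h3, h4⟩)
    · exact hD.asymm h1 h3
    · exact hD.not_missing h1 h3.symm
    · exact hD.not_missing h3 h1.symm
    · have := hτ2 u v (hnc hu hv h1) h1
      tauto
  obtain ⟨p, hp, hfb⟩ := exists_feedbackProperty S T ω hω
  have hSne : S.Nonempty := by
    obtain ⟨v⟩ := ‹Nonempty V›
    exact ⟨ρ v, hS.2 (hidem v)⟩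
  obtain ⟨f, hfS, hf⟩ := S.exists_max_image p hSne
  refine ⟨f, ?_⟩
  have hρf := hS.1 hfS
  have hinf := hin f
  rw [hρf] at hinf
  have hsum : ∀ (P : V → Prop) [DecidablePred P], ∑ u ∈ S with P u, ω u =
      (Finset.univ.filter fun v => P (ρ v)).card := fun P _ => sum_card_fiber hidem P
  have hTff : ∀ {w}, w ∈ S → T w f → w ≠ f ∧ ¬ D.Adj f w := by
    intro w hw h
    refine ⟨?_, fun h' => hasymm f hfS w hw (Or.inl h') h⟩
    rintro rfl
    exact hasymm w hw w hw h h
  have hsec : ∀ u ∈ S, ∀ w ∈ S, D.Adj f u → w ≠ f → ¬ D.Adj f w → T u w →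
      w ∈ D.secondOutNbhd f ∨ (D.Follows f w ∧ τ f ∧ ¬ D.Cyclic w) :=
    fun u hu w hw h1 h2 h3 h4 => hD.mem_second_or_follows hτ1 hτ2 hτ3 h1
      (h4.imp_right fun h => ⟨h.1, h.2, hnc hu hw h.1⟩) h2 h3
  by_cases hy : ∃ y ∈ S, D.missingGraph.Adj f y ∧ τ f
  swap
  · have key := hfb.weight_le hp htot hasymm hfS hf
    rw [hsum, hsum] at key
    refine hasSNP_of_card_le hadj hidem hρf hinf (le_trans (Finset.card_le_card fun v hv => ?_)
      (key.trans (Finset.card_le_card fun v hv => ?_)))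
    · simp only [Finset.mem_filter, Finset.mem_univ, true_and] at hv ⊢
      exact Or.inl hv
    · simp only [Finset.mem_filter, Finset.mem_univ, true_and] at hv ⊢
      obtain ⟨hwf, u, hu, hfu, huw⟩ := hv
      have hw := hS.2 (hidem v)
      obtain ⟨h2, h3⟩ := hTff hw hwf
      refine (hsec u hu _ hw (hfu.resolve_right fun h => hy ⟨u, hu, h⟩) h2 h3 huw).resolve_right ?_
      rintro ⟨h5, h6, h7⟩
      obtain ⟨y, hfy⟩ := h5.exists_left
      have hcf : ¬ D.Cyclic f := fun h => h7 (hD.cyclic_of_follows h h5)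
      exact hy ⟨y, hncS fun h => hcf (hD.cyclic_opp h hfy.symm), hfy, h6⟩
  obtain ⟨y, hyS, hfy, hτf⟩ := hy
  have hcf := hnc hfS hyS hfy
  have huniq : ∀ {u}, T f u → u ≠ y → D.Adj f u := fun h hne =>
    h.resolve_right fun h' => hne (hD.eq_of_missing hC hcf h'.1 hfy)
  by_cases hb : ∃ b, D.Follows f b
  swap
  · have key := hfb.weight_le_of_reverse hp htot hasymm hfS hf hfy.1
    rw [hsum, hsum] at key
    refine hasSNP_of_card_le hadj hidem hρf hinf (le_trans (Finset.card_le_card fun v hv => ?_)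
      (key.trans (Finset.card_le_card fun v hv => ?_)))
    · simp only [Finset.mem_filter, Finset.mem_univ, true_and] at hv ⊢
      refine ⟨Or.inl hv, fun e => ?_⟩
      rw [e] at hv
      exact hD.not_missing hv hfy
    · simp only [Finset.mem_filter, Finset.mem_univ, true_and] at hv ⊢
      obtain ⟨hwf, hwy, u, hu, ⟨hfu, huy⟩, huw⟩ := hv
      have hw := hS.2 (hidem v)
      have h3 : ¬ D.Adj f (ρ v) := by
        rcases hwy with h | h
        · exact (hTff hw h).2
        · rw [h]; exact fun h' => hD.not_missing h' hfy
      exact (hsec u hu _ hw (huniq hfu huy) hwf h3 huw).resolve_right fun h => hb ⟨_, h.1⟩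
  · obtain ⟨b, hb⟩ := hb
    obtain ⟨a, hab⟩ := hb.exists_right
    have hcb : ¬ D.Cyclic b := fun h => hcf (hD.cyclic_of_follows' h hb)
    have key := hfb.weight_le hp htot hasymm hfS hf
    rw [hsum, hsum] at key
    have hy' : ρ y = y := hS.1 hyS
    have hleft : (Finset.univ.filter fun v => D.Adj f (ρ v)).card + 1 ≤
        (Finset.univ.filter fun v => T f (ρ v)).card := by
      rw [← Finset.card_insert_of_notMem (a := y)]
      · refine Finset.card_le_card fun v hv => ?_
        simp only [Finset.mem_insert, Finset.mem_filter, Finset.mem_univ, true_and] at hv ⊢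
        rcases hv with rfl | hv
        · rw [hy']; exact Or.inr ⟨hfy, hτf⟩
        · exact Or.inl hv
      · simp only [Finset.mem_filter, Finset.mem_univ, true_and, hy']
        exact fun h => hD.not_missing h hfy
    have hright : (Finset.univ.filter fun v => T (ρ v) f ∧ ∃ u ∈ S, T f u ∧ T u (ρ v)).card ≤
        (Finset.univ.filter fun v => ρ v ∈ D.secondOutNbhd f).card + 1 := by
      refine (Finset.card_le_card fun v hv => ?_).trans (Finset.card_insert_le b _)
      simp only [Finset.mem_insert, Finset.mem_filter, Finset.mem_univ, true_and] at hv ⊢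
      obtain ⟨hwf, u, hu, hfu, huw⟩ := hv
      have hw := hS.2 (hidem v)
      obtain ⟨h2, h3⟩ := hTff hw hwf
      rw [or_comm, or_iff_not_imp_right]
      intro hvb
      have hwb : b ≠ ρ v := by
        intro e
        exact hvb (hinj v b hcb (by rw [e, hidem]))
      by_cases huy : u = y
      · rw [huy] at huw
        have hyw : D.Adj y (ρ v) := by
          refine huw.resolve_right fun h => h2 (hD.eq_of_missing hC ?_ h.1 hfy.symm)
          exact fun h => hcf (hD.cyclic_opp h hfy.symm)
        have hya := hD.opp hb hfy hab
        have hne : a ≠ ρ v := by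
          rintro e
          rw [← e] at hyw
          exact hD.asymm hyw (hD.adj hya)
        have hm : ¬ D.missingGraph.Adj a (ρ v) := fun h =>
          hwb (hD.eq_of_missing hC (fun h' => hcb (hD.cyclic_opp h' hab)) hab h)
        exact ⟨h2, h3, a, hD.fwd hb hab, (adj_or_adj hne hm).resolve_right (hD.not_adj hya hyw)⟩
      · refine (hsec u hu _ hw (huniq hfu huy) h2 h3 huw).resolve_right fun h => ?_
        obtain ⟨z, h5, h6⟩ := hD.right_unique hb h.1
        exact hcb (hD.cyclic_of_ne hC h5 h6 hwb)
    exact hasSNP_of_card_le hadj hidem hρf hinf (by omega)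

end Digraph

theorem mainTheorem3 {V : Type u} [Finite V] [Nonempty V] (D : Digraph V)
    (hD : D.IsOriented) (hpaths : D.MissesDisjointPaths 2)
    (hcycles : D.PathsFormDoubleCycles) :
    ∃ v : V, D.HasSNP v :=
  ((hpaths.missesShortPaths hD).tame hcycles).exists_hasSNP hcycles
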